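/- **Theorem 4.1 (Hindman + CLT).** Let $\mathbb N=\{0,1,2,\dots\}$ be finitely coloured and let $x=(x_i)$ be a sequence in $\mathbb N$ whose set of finite sums $$\mathrm{FS}(x)=\Big\{\sum_{i\in F}x_i : F \text{ a nonempty finite set of indices}\Big\}$$ is monochromatic. Fix $p\in(0,1)$ and let $(\varepsilon_i)$ be i.i.d. $\mathrm{Bernoulli}(p)$ random variables. Let $y_k=x_{n_k}$ ($n_1<n_2<\cdots$) be a subsequence of $x$ with pairwise distinct terms and $\sum_{j}y_j^2=\infty$. Put $$S_k=\sum_{j=1}^k\varepsilon_{n_j}y_j,\qquad \mu_k=\mathbb E[S_k],\qquad \sigma_k^2=\operatorname{Var}(S_k).$$ For indices $j_k\in\{1,\dots,k\}$ ($k\ge1$), chosen deterministically, put $$S_k^{\mathrm{trim}}=\sum_{j\le k,\ j\ne j_k}\varepsilon_{n_j}y_j,\qquad R_k=\sum_{j\le k,\ j\ne j_k}y_j^2,\qquad \sigma_k^{\mathrm{trim}}=\sqrt{p(1-p)R_k}.$$ Then $\mu_k=p\sum_{j\le k}y_j$, $\sigma_k^2=p(1-p)\sum_{j\le k}y_j^2$,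 $\mathbb E[S_k^{\mathrm{trim}}]=p\sum_{j\le k,\,j\ne j_k}y_j$ and $\operatorname{Var}(S_k^{\mathrm{trim}})=p(1-p)R_k$; moreover the following hold. **(A)** Suppose that $y_{j_k}^2=\max_{j\le k}y_j^2$ for all $k\ge1$ and that $$\frac{y_{j_k}^2}{y_{j_k}^2+R_k}\to1 .$$ Then $\operatorname{Var}(\varepsilon_{n_{j_k}}y_{j_k})/\sigma_k^2\to1$ and $$\frac{S_k-\mu_k}{\sigma_k}\xrightarrow{d}\frac{B-p}{\sqrt{p(1-p)}},\qquad B\sim\mathrm{Bernoulli}(p);$$ equivalently, the limit law is the two-point law giving mass $p$ to $\frac{1-p}{\sqrt{p(1-p)}}$ and mass $1-p$ to $\frac{-p}{\sqrt{p(1-p)}}$. In particular $(S_k-\mu_k)/\sigma_k$ does not converge in distribution to any nondegenerate Gaussian law. **(B)** Let $j_k\in\{1,\dots,k\}$ be any deterministic choice of indices (for instance argmax indices) such that $$p(1-p)R_k\to\infty\qquad\text{and}\qquad \frac{\max_{j\le k,\ j\ne j_k}y_j^2}{R_k}\to0 .$$ Then the centred trimmed summands satisfy the Lindeberg condition: for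 every $\delta>0$, $$\frac1{(\sigma_k^{\mathrm{trim}})^2}\sum_{j\le k,\ j\ne j_k}\mathbb E\Big[Z_j^2\,\mathbf 1_{\{|Z_j|>\delta\sigma_k^{\mathrm{trim}}\}}\Big]\to0,\qquad Z_j=\varepsilon_{n_j}y_j-p\,y_j,$$ and $$\frac{S_k^{\mathrm{trim}}-\mathbb E[S_k^{\mathrm{trim}}]}{\sigma_k^{\mathrm{trim}}}\xrightarrow{d}\mathcal N(0,1).$$ If moreover $y_{j_k}^2/R_k\to0$, then $$\frac{S_k-\mu_k}{\sigma_k^{\mathrm{trim}}}\xrightarrow{d}\mathcal N(0,1).$$ If instead $y_{j_k}^2/R_k\not\to0$, then $(S_k-\mu_k)/\sigma_k^{\mathrm{trim}}$ does not converge in distribution to any Gaussian law. **Atoms.** In all cases, for every $k$, every atom $v$ of $S_k$ (that is, every real $v$ with $\mathbb P(S_k=v)>0$) is of the form $v=\sum_{j\in F}y_j$ with a (possibly empty) $F\subseteq\{1,\dots,k\}$, and if $v\ne0$ then $v\in\mathrm{FS}(x)$. The same holds for every trimmed sum, obtained from $S_k$ by leaving out one index $i$, with $F\subseteq\{1,\dots,k\}\setminus\{i\}$.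 -/

import Mathlib

open MeasureTheory ProbabilityTheory Filter Topology

noncomputable section

namespace HindmanCLT

variable {Ω : Type*}

/-- The full sum `S_k = ∑ ε_{n_j} y_j` over the first `k` indices (indices start at `0`, so that
the first `k` indices are those in `Finset.range k`). -/
def fullSum (ε : ℕ → Ω → ℝ) (n y : ℕ → ℕ) (k : ℕ) (ω : Ω) : ℝ :=
  ∑ j ∈ Finset.range k, ε (n j) ω * (y j : ℝ)

/-- The trimmed sum: the sum over the first `k` indices with the index `i` left out. -/
def trimmedSum (ε : ℕ → Ω → ℝ) (n y : ℕ → ℕ) (i k : ℕ) (ω : Ω) : ℝ :=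
  ∑ j ∈ (Finset.range k).erase i, ε (n j) ω * (y j : ℝ)

/-- The residual squared sum: the squares of the first `k` terms with the index `i` left out. -/
def residual (y : ℕ → ℕ) (i k : ℕ) : ℝ :=
  ∑ j ∈ (Finset.range k).erase i, (y j : ℝ) ^ 2

/-- The largest square among the first `k` terms with the index `i` left out
(`0` if no term is left). -/
def maxRemaining (y : ℕ → ℕ) (i k : ℕ) : ℕ :=
  ((Finset.range k).erase i).sup fun j => y j ^ 2

/-- The trimmed standard deviation `√(p (1 - p) R_k)`. -/
def trimmedSd (p : ℝ) (y : ℕ → ℕ) (i k : ℕ) : ℝ :=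
  √(p * (1 - p) * residual y i k)

/-- `j` chooses, for every stage `k ≥ 1`, one of the first `k` indices. -/
def IsIndexChoice (j : ℕ → ℕ) : Prop :=
  ∀ k, 1 ≤ k → j k < k

/-- `j` chooses, for every stage `k ≥ 1`, an index of a term with the largest square among the
first `k` terms. -/
def IsArgmaxChoice (y j : ℕ → ℕ) : Prop :=
  ∀ k, 1 ≤ k → j k < k ∧ ∀ i < k, y i ^ 2 ≤ y (j k) ^ 2

/-- Lindeberg's condition for a triangular array `Z k j` (`j ∈ J k`) of centred random variables
and normalising constants `s k`: for every `δ > 0`,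
`s_k⁻² ∑_{j ∈ J k} E[Z_{k,j}² 1_{|Z_{k,j}| > δ s_k}] → 0`. -/
def LindebergCondition [MeasurableSpace Ω] (P : Measure Ω) (J : ℕ → Finset ℕ)
    (Z : ℕ → ℕ → Ω → ℝ) (s : ℕ → ℝ) : Prop :=
  ∀ δ : ℝ, 0 < δ →
    Tendsto (fun k => (∑ j ∈ J k, ∫ ω in {ω | δ * s k < |Z k j ω|}, (Z k j ω) ^ 2 ∂P) / (s k) ^ 2)
      atTop (𝓝 0)

end HindmanCLT

end

/-!
The finite-sums hypothesis only enters through the atoms: almost surely every `ε i` is `0` or `1`,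
so an atom of a weighted sum is a sum of the terms over some finite index set, and such a sum over
a nonempty set is a finite sum of `x` because `n` is injective.

All limit laws are obtained from characteristic functions and Lévy's convergence theorem. By
independence the characteristic function of a centred weighted sum divided by `σ` is a product of
factors `ψ(w_j t / σ)`, with `ψ = centredCharFun p` the characteristic function of `ε - p`.

* If one term carries asymptotically all of the variance, the squared arguments of the other factors
  sum to `o(1)`, and `ψ(s) = 1 + O(s ^ 2)` makes their product tend to `1`
  (`tendsto_charFun_of_dominated`). Only the dominant two-valued variable is left, and its law has
  atoms, unlike a nondegenerate Gaussian.
* If all terms are negligible, `ψ(s) = exp (-p (1 - p) s ^ 2 / 2) + O(|s| ^ 3)` turns the product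
  into `exp (-t ^ 2 / 2)` (`tendsto_charFun_of_negligible`). Lindeberg's condition is immediate: the
  summands are bounded by their weights, so the truncated integrals vanish eventually.
* Restoring the omitted term multiplies the characteristic function of the trimmed sum by
  `ψ(a_k t)`, with `a_k` the omitted weight divided by the trimmed standard deviation. If `a_k → 0`,
  this factor tends to `1`. Conversely, if the full sum has a Gaussian limit, then `|ψ(a_k t)| ^ 2`
  converges to `exp (c t ^ 2)` for some real `c`; as `|ψ| ^ 2` is an affine function of the cosine,
  the duplication formula for the cosine forces `c = 0` and then `a_k → 0`
  (`tendsto_zero_of_tendsto_norm_sq_centredCharFun`). This treats bounded and unbounded `a_k`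
  alike.
-/

/-! ### The characteristic function of a centred Bernoulli variable -/

namespace HindmanCLT

/-- The characteristic function of `ε - p` for a Bernoulli(`p`) variable `ε`, in closed form. -/
noncomputable def centredCharFun (p s : ℝ) : ℂ :=
  p * Complex.exp (((1 - p) * s : ℝ) * Complex.I)
    + (1 - p : ℝ) * Complex.exp ((-p * s : ℝ) * Complex.I)

lemma continuous_centredCharFun (p : ℝ) : Continuous (centredCharFun p) := by
  unfold centredCharFun; fun_prop

@[simp]
lemma centredCharFun_zero (p : ℝ) : centredCharFun p 0 = 1 := by
  simp [centredCharFun]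

lemma norm_centredCharFun_le_one {p : ℝ} (hp0 : 0 ≤ p) (hp1 : p ≤ 1) (s : ℝ) :
    ‖centredCharFun p s‖ ≤ 1 := by
  refine (norm_add_le _ _).trans ?_
  rw [norm_mul, norm_mul, Complex.norm_exp_ofReal_mul_I, Complex.norm_exp_ofReal_mul_I,
    Complex.norm_real, Complex.norm_real, Real.norm_of_nonneg hp0,
    Real.norm_of_nonneg (by linarith)]
  linarith

lemma norm_sq_centredCharFun (p s : ℝ) :
    ‖centredCharFun p s‖ ^ 2 = 1 - 2 * (p * (1 - p)) * (1 - Real.cos s) := by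
  have hs : Real.cos s = Real.cos ((1 - p) * s) * Real.cos (-p * s)
      + Real.sin ((1 - p) * s) * Real.sin (-p * s) := by
    rw [← Real.cos_sub]; congr 1; ring
  rw [← Complex.normSq_eq_norm_sq, hs, centredCharFun, Complex.exp_mul_I, Complex.exp_mul_I,
    ← Complex.ofReal_cos, ← Complex.ofReal_sin, ← Complex.ofReal_cos, ← Complex.ofReal_sin,
    Complex.normSq_apply]
  simp only [Complex.add_re, Complex.mul_re, Complex.ofReal_re, Complex.ofReal_im, Complex.I_re,
    Complex.I_im, Complex.add_im, Complex.mul_im]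
  have h1 := Real.sin_sq_add_cos_sq ((1 - p) * s)
  have h2 := Real.sin_sq_add_cos_sq (-p * s)
  linear_combination p ^ 2 * h1 + (1 - p) ^ 2 * h2

lemma norm_centredCharFun_sub_one_le {p : ℝ} (hp0 : 0 ≤ p) (hp1 : p ≤ 1) {s : ℝ} (hs : |s| ≤ 1) :
    ‖centredCharFun p s - 1‖ ≤ s ^ 2 := by
  have key (c : ℝ) (hc : |c| ≤ 1) :
      ‖Complex.exp ((c * s : ℝ) * Complex.I) - 1 - (c * s : ℝ) * Complex.I‖ ≤ s ^ 2 := by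
    have hcs : |c * s| ≤ |s| := by
      rw [abs_mul]; exact mul_le_of_le_one_left (abs_nonneg s) hc
    have hn : ‖((c * s : ℝ) : ℂ) * Complex.I‖ = |c * s| := by simp
    refine (Complex.norm_exp_sub_one_sub_id_le (by rw [hn]; exact hcs.trans hs)).trans ?_
    rw [hn, ← sq_abs s]
    gcongr
  have e : centredCharFun p s - 1 =
      p * (Complex.exp (((1 - p) * s : ℝ) * Complex.I) - 1 - ((1 - p) * s : ℝ) * Complex.I)
      + (1 - p : ℝ) * (Complex.exp ((-p * s : ℝ) * Complex.I) - 1 - (-p * s : ℝ) * Complex.I) := by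
    unfold centredCharFun; push_cast; ring
  rw [e]
  refine (norm_add_le _ _).trans ?_
  rw [norm_mul, norm_mul, Complex.norm_real, Complex.norm_real, Real.norm_of_nonneg hp0,
    Real.norm_of_nonneg (by linarith : 0 ≤ 1 - p)]
  have h1 := key (1 - p) (by rw [abs_le]; constructor <;> linarith)
  have h2 := key (-p) (by rw [abs_le]; constructor <;> linarith)
  nlinarith

/-- Third-order comparison with the Gaussian of the same variance `p (1 - p)`. -/
lemma norm_centredCharFun_sub_exp_le {p : ℝ} (hp0 : 0 ≤ p) (hp1 : p ≤ 1) {s : ℝ} (hs : |s| ≤ 1) :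
    ‖centredCharFun p s - Real.exp (-(p * (1 - p) * s ^ 2 / 2))‖ ≤ 2 * |s| ^ 3 := by
  have key (c : ℝ) (hc : |c| ≤ 1) :
      ‖Complex.exp ((c * s : ℝ) * Complex.I)
        - (1 + (c * s : ℝ) * Complex.I - ((c * s) ^ 2 / 2 : ℝ))‖ ≤ |s| ^ 3 := by
    have hcs : |c * s| ≤ |s| := by
      rw [abs_mul]; exact mul_le_of_le_one_left (abs_nonneg s) hc
    have hn : ‖((c * s : ℝ) : ℂ) * Complex.I‖ = |c * s| := by simp
    have h := Complex.exp_bound (x := ((c * s : ℝ) : ℂ) * Complex.I)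
      (by rw [hn]; exact hcs.trans hs) (n := 3) (by norm_num)
    have e : ∑ m ∈ Finset.range 3, (((c * s : ℝ) : ℂ) * Complex.I) ^ m / (m.factorial : ℂ)
        = 1 + (c * s : ℝ) * Complex.I - ((c * s) ^ 2 / 2 : ℝ) := by
      simp only [Finset.sum_range_succ, Finset.sum_range_zero, mul_pow, Complex.I_sq]
      simp [Nat.factorial]; ring
    rw [e, hn] at h
    refine h.trans ?_
    have : |c * s| ^ 3 ≤ |s| ^ 3 := by gcongr
    have h0 : 0 ≤ |c * s| ^ 3 := by positivity
    have hc : ((Nat.succ 3 : ℕ) : ℝ) * (((Nat.factorial 3 : ℕ) : ℝ) * ((3 : ℕ) : ℝ))⁻¹ ≤ 1 := by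
      norm_num [Nat.factorial]
    exact (mul_le_of_le_one_right h0 hc).trans this
  set q := p * (1 - p) with hq
  have hq0 : 0 ≤ q := mul_nonneg hp0 (by linarith)
  have hq1 : q ≤ 1 := by nlinarith
  have hs1 : s ^ 2 ≤ 1 := by rw [← sq_abs]; exact pow_le_one₀ (abs_nonneg s) hs
  have hexp : |Real.exp (-(q * s ^ 2 / 2)) - 1 - (-(q * s ^ 2 / 2))| ≤ |s| ^ 3 := by
    refine (Real.abs_exp_sub_one_sub_id_le ?_).trans ?_
    · rw [abs_neg, abs_of_nonneg (by positivity)]; nlinarith [sq_nonneg s]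
    · have h4 : s ^ 4 ≤ |s| ^ 3 := by
        rw [← (show Even 4 by decide).pow_abs]
        exact pow_le_pow_of_le_one (abs_nonneg s) hs (by norm_num)
      have : q ^ 2 ≤ 1 := pow_le_one₀ hq0 hq1
      have h0 : 0 ≤ s ^ 4 := by positivity
      nlinarith
  have e : centredCharFun p s - Real.exp (-(q * s ^ 2 / 2)) =
      p * (Complex.exp (((1 - p) * s : ℝ) * Complex.I)
        - (1 + ((1 - p) * s : ℝ) * Complex.I - (((1 - p) * s) ^ 2 / 2 : ℝ)))
      + (1 - p : ℝ) * (Complex.exp ((-p * s : ℝ) * Complex.I)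
        - (1 + (-p * s : ℝ) * Complex.I - ((-p * s) ^ 2 / 2 : ℝ)))
      - (Real.exp (-(q * s ^ 2 / 2)) - 1 - (-(q * s ^ 2 / 2)) : ℝ) := by
    unfold centredCharFun; rw [hq]; push_cast; ring
  rw [e]
  refine (norm_sub_le _ _).trans ?_
  refine (add_le_add_left (norm_add_le _ _) _).trans ?_
  rw [norm_mul, norm_mul, Complex.norm_real, Complex.norm_real, Real.norm_of_nonneg hp0,
    Real.norm_of_nonneg (by linarith : 0 ≤ 1 - p), Complex.norm_real, Real.norm_eq_abs]
  have h1 := key (1 - p) (by rw [abs_le]; constructor <;> linarith)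
  have h2 := key (-p) (by rw [abs_le]; constructor <;> linarith)
  nlinarith

/-! ### Products of characteristic functions -/

lemma norm_prod_sub_prod_le {ι : Type*} (s : Finset ι) (z w : ι → ℂ)
    (hz : ∀ i ∈ s, ‖z i‖ ≤ 1) (hw : ∀ i ∈ s, ‖w i‖ ≤ 1) :
    ‖∏ i ∈ s, z i - ∏ i ∈ s, w i‖ ≤ ∑ i ∈ s, ‖z i - w i‖ := by
  induction s using Finset.cons_induction with
  | empty => simp
  | cons a s ha ih =>
    rw [Finset.prod_cons, Finset.prod_cons, Finset.sum_cons]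
    have e : z a * ∏ i ∈ s, z i - w a * ∏ i ∈ s, w i =
        (z a - w a) * ∏ i ∈ s, z i + w a * (∏ i ∈ s, z i - ∏ i ∈ s, w i) := by ring
    rw [e]
    refine (norm_add_le _ _).trans (add_le_add ?_ ?_)
    · rw [norm_mul]
      refine mul_le_of_le_one_right (norm_nonneg _) ?_
      rw [norm_prod]
      exact Finset.prod_le_one (fun _ _ => norm_nonneg _)
        fun i hi => hz i (Finset.mem_cons_of_mem hi)
    · rw [norm_mul]
      refine (mul_le_of_le_one_left (norm_nonneg _) (hw a (Finset.mem_cons_self a s))).trans ?_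
      exact ih (fun i hi => hz i (Finset.mem_cons_of_mem hi))
        (fun i hi => hw i (Finset.mem_cons_of_mem hi))

/-- The characteristic-function form of Lindeberg's theorem for weighted centred Bernoulli
variables: unit variance and uniformly negligible weights give the standard Gaussian. -/
lemma tendsto_prod_centredCharFun {p : ℝ} (hp0 : 0 ≤ p) (hp1 : p ≤ 1)
    (J : ℕ → Finset ℕ) (a : ℕ → ℕ → ℝ) (m : ℕ → ℝ)
    (hsum : ∀ᶠ k in atTop, p * (1 - p) * ∑ j ∈ J k, a k j ^ 2 = 1)
    (ham : ∀ᶠ k in atTop, ∀ j ∈ J k, |a k j| ≤ m k) (hm : Tendsto m atTop (𝓝 0)) (t : ℝ) :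
    Tendsto (fun k => ∏ j ∈ J k, centredCharFun p (a k j * t)) atTop
      (𝓝 ((Real.exp (-(t ^ 2 / 2)) : ℝ) : ℂ)) := by
  rw [tendsto_iff_norm_sub_tendsto_zero]
  have hmt : Tendsto (fun k => m k * |t|) atTop (𝓝 0) := by simpa using hm.mul_const |t|
  have hb : Tendsto (fun k => 2 * (m k * |t|) * (t ^ 2 / (p * (1 - p)))) atTop (𝓝 0) := by
    simpa using (hmt.const_mul 2).mul_const (t ^ 2 / (p * (1 - p)))
  refine squeeze_zero' (Eventually.of_forall fun _ => norm_nonneg _) ?_ hb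
  filter_upwards [hsum, ham, hmt.eventually (gt_mem_nhds one_pos)] with k hk1 hk2 hk3
  have hq : p * (1 - p) ≠ 0 := left_ne_zero_of_mul (hk1 ▸ one_ne_zero)
  have hsmall (j) (hj : j ∈ J k) : |a k j * t| ≤ m k * |t| := by
    rw [abs_mul]; exact mul_le_mul_of_nonneg_right (hk2 j hj) (abs_nonneg t)
  have hprod : ((Real.exp (-(t ^ 2 / 2)) : ℝ) : ℂ)
      = ∏ j ∈ J k, ((Real.exp (-(p * (1 - p) * (a k j * t) ^ 2 / 2)) : ℝ) : ℂ) := by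
    rw [← Complex.ofReal_prod, ← Real.exp_sum]
    congr 2
    rw [Finset.sum_neg_distrib, ← Finset.sum_div]
    simp_rw [mul_pow, ← mul_assoc]
    rw [← Finset.sum_mul, ← Finset.mul_sum, hk1, one_mul]
  rw [hprod]
  refine (norm_prod_sub_prod_le _ _ _
    (fun j _ => norm_centredCharFun_le_one hp0 hp1 _) fun j _ => ?_).trans ?_
  · rw [Complex.norm_real, Real.norm_of_nonneg (Real.exp_pos _).le, Real.exp_le_one_iff]
    have : 0 ≤ p * (1 - p) := mul_nonneg hp0 (by linarith)
    have : 0 ≤ p * (1 - p) * (a k j * t) ^ 2 := by positivity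
    linarith
  calc ∑ j ∈ J k, ‖centredCharFun p (a k j * t)
          - ((Real.exp (-(p * (1 - p) * (a k j * t) ^ 2 / 2)) : ℝ) : ℂ)‖
      ≤ ∑ j ∈ J k, 2 * (m k * |t|) * (a k j ^ 2 * t ^ 2) := by
        refine Finset.sum_le_sum fun j hj => ?_
        refine (norm_centredCharFun_sub_exp_le hp0 hp1 ((hsmall j hj).trans hk3.le)).trans ?_
        rw [pow_succ', sq_abs, mul_pow, ← mul_assoc]
        gcongr
        exact hsmall j hj
    _ = 2 * (m k * |t|) * (t ^ 2 / (p * (1 - p))) := by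
        rw [← Finset.mul_sum, ← Finset.sum_mul]
        have : ∑ j ∈ J k, a k j ^ 2 = 1 / (p * (1 - p)) := by
          rw [eq_div_iff hq, mul_comm]; exact hk1
        rw [this]; ring

/-- Weights of vanishing total square contribute nothing in the limit. -/
lemma tendsto_prod_centredCharFun_one {p : ℝ} (hp0 : 0 ≤ p) (hp1 : p ≤ 1)
    (J : ℕ → Finset ℕ) (a : ℕ → ℕ → ℝ)
    (hsum : Tendsto (fun k => ∑ j ∈ J k, a k j ^ 2) atTop (𝓝 0)) (t : ℝ) :
    Tendsto (fun k => ∏ j ∈ J k, centredCharFun p (a k j * t)) atTop (𝓝 1) := by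
  rw [tendsto_iff_norm_sub_tendsto_zero]
  have hb : Tendsto (fun k => (∑ j ∈ J k, a k j ^ 2) * t ^ 2) atTop (𝓝 0) := by
    simpa using hsum.mul_const (t ^ 2)
  refine squeeze_zero' (Eventually.of_forall fun _ => norm_nonneg _) ?_ hb
  filter_upwards [hb.eventually (gt_mem_nhds one_pos)] with k hk
  have h := norm_prod_sub_prod_le (J k) (fun j => centredCharFun p (a k j * t)) (fun _ => 1)
    (fun j _ => norm_centredCharFun_le_one hp0 hp1 _) (by simp)
  rw [Finset.prod_const_one] at h
  refine h.trans ?_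
  rw [Finset.sum_mul] at hk ⊢
  refine Finset.sum_le_sum fun j hj => ?_
  rw [← mul_pow]
  refine norm_centredCharFun_sub_one_le hp0 hp1 ?_
  rw [← sq_le_one_iff_abs_le_one, mul_pow]
  exact (Finset.single_le_sum (f := fun j => a k j ^ 2 * t ^ 2)
    (fun i _ => by positivity) hj).trans hk.le

/-- If every `cos (a_k t)` tends to `1`, then `a_k` tends to `0`: the Dirac masses at `a_k`
converge weakly by Lévy's theorem. -/
lemma tendsto_zero_of_tendsto_cos {a : ℕ → ℝ}
    (h : ∀ t : ℝ, Tendsto (fun k => Real.cos (a k * t)) atTop (𝓝 1)) :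
    Tendsto a atTop (𝓝 0) := by
  have hd : Tendsto (fun k => diracProba (a k)) atTop (𝓝 (diracProba (0 : ℝ))) := by
    refine ProbabilityMeasure.tendsto_iff_tendsto_charFun.2 fun t => ?_
    have e (x : ℝ) : charFun ((diracProba x : ProbabilityMeasure ℝ) : Measure ℝ) t
        = Complex.exp ((x * t : ℝ) * Complex.I) := by
      simp [diracProba, charFun_dirac, mul_comm]
    simp_rw [e, zero_mul, Complex.ofReal_zero, zero_mul, Complex.exp_zero]
    rw [tendsto_iff_norm_sub_tendsto_zero]
    have hsq : Tendsto (fun k => √(2 - 2 * Real.cos (a k * t))) atTop (𝓝 0) := by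
      have := (((h t).const_mul 2).const_sub 2).sqrt
      simpa using this
    refine hsq.congr fun k => ?_
    rw [Real.sqrt_eq_iff_eq_sq (by linarith [Real.cos_le_one (a k * t)]) (norm_nonneg _)]
    have h1 := Real.sin_sq_add_cos_sq (a k * t)
    rw [← Complex.normSq_eq_norm_sq, Complex.exp_mul_I, ← Complex.ofReal_cos, ← Complex.ofReal_sin,
      Complex.normSq_apply]
    simp only [Complex.sub_re, Complex.add_re, Complex.mul_re, Complex.ofReal_re,
      Complex.ofReal_im, Complex.I_re, Complex.I_im, Complex.sub_im, Complex.add_im,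
      Complex.mul_im, Complex.one_re, Complex.one_im]
    linear_combination -h1
  exact isEmbedding_diracProba.tendsto_nhds_iff.2 hd

/-- If the squared moduli of the characteristic functions of `a_k (ε - p)` converge to
`exp (c t ^ 2)`, then `a_k → 0`. Up to an affine change of variables the squared modulus is
`cos (a_k t)`, so `E t = exp (c t ^ 2)` is an affine image of a limit of cosines. The duplication
formula, with `E (2 t) = E t ^ 4`, then gives `p (1 - p) (3 + 2 E t + E t ^ 2) = 1` whenever
`E t ≠ 1`; for `c ≠ 0` this cannot hold at both `t = 1` and `t = 2`. -/
lemma tendsto_zero_of_tendsto_norm_sq_centredCharFun {p : ℝ} (hp0 : 0 < p) (hp1 : p < 1)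
    {a : ℕ → ℝ} {c : ℝ}
    (h : ∀ t : ℝ, Tendsto (fun k => ‖centredCharFun p (a k * t)‖ ^ 2) atTop
      (𝓝 (Real.exp (c * t ^ 2)))) :
    Tendsto a atTop (𝓝 0) := by
  set q := p * (1 - p) with hq
  have hq0 : 0 < q := mul_pos hp0 (by linarith)
  have hcos (t : ℝ) : Tendsto (fun k => Real.cos (a k * t)) atTop
      (𝓝 (1 - (1 - Real.exp (c * t ^ 2)) / (2 * q))) := by
    refine ((((h t).const_sub 1).div_const (2 * q)).const_sub 1).congr fun k => ?_
    rw [norm_sq_centredCharFun]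
    field_simp
    ring
  have hdup (t : ℝ) : 1 - (1 - Real.exp (c * t ^ 2) ^ 4) / (2 * q)
      = 2 * (1 - (1 - Real.exp (c * t ^ 2)) / (2 * q)) ^ 2 - 1 := by
    refine tendsto_nhds_unique ?_ ((((hcos t).pow 2).const_mul 2).sub_const 1)
    have e : Real.exp (c * t ^ 2) ^ 4 = Real.exp (c * (2 * t) ^ 2) := by
      rw [← Real.exp_nat_mul]; congr 1; push_cast; ring
    rw [e]
    refine (hcos (2 * t)).congr fun k => ?_
    rw [← Real.cos_two_mul]; congr 1; ring
  have hpoly (t : ℝ) (hE : Real.exp (c * t ^ 2) ≠ 1) :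
      q * (3 + 2 * Real.exp (c * t ^ 2) + Real.exp (c * t ^ 2) ^ 2) = 1 := by
    have h1 := hdup t
    set E := Real.exp (c * t ^ 2)
    have hE' : 1 - E ≠ 0 := sub_ne_zero.2 hE.symm
    field_simp at h1
    apply mul_left_cancel₀ hE'
    apply mul_left_cancel₀ hE'
    linear_combination h1
  have hc : c = 0 := by
    by_contra hc
    have hE1 : Real.exp (c * 1 ^ 2) ≠ 1 := by simpa using hc
    have hE2 : Real.exp (c * 2 ^ 2) ≠ 1 := by simpa using hc
    have h1 := hpoly 1 hE1
    have h2 := hpoly 2 hE2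
    have hne : Real.exp (c * 1 ^ 2) ≠ Real.exp (c * 2 ^ 2) := by
      intro h; have := Real.exp_injective h; apply hc; linarith
    have e1 := Real.exp_pos (c * 1 ^ 2)
    have e2 := Real.exp_pos (c * 2 ^ 2)
    -- The difference of the two identities factors, and its second factor is positive.
    have h3 : (Real.exp (c * 1 ^ 2) - Real.exp (c * 2 ^ 2))
        * (q * (2 + Real.exp (c * 1 ^ 2) + Real.exp (c * 2 ^ 2))) = 0 := by
      linear_combination h1 - h2
    rcases mul_eq_zero.1 h3 with h | h
    · exact hne (sub_eq_zero.1 h)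
    · have : 0 < q * (2 + Real.exp (c * 1 ^ 2) + Real.exp (c * 2 ^ 2)) := by positivity
      exact this.ne' h
  refine tendsto_zero_of_tendsto_cos fun t => ?_
  simpa [hc] using hcos t

/-! ### Weighted sums of independent Bernoulli variables -/

section Bernoulli

variable {Ω : Type*} [MeasurableSpace Ω] {P : Measure Ω}
  {p : unitInterval}

lemma ae_eq_zero_or_one {X : Ω → ℝ} (hX : HasLaw X (bernoulliMeasure (1 : ℝ) 0 p) P) :
    ∀ᵐ ω ∂P, X ω = 0 ∨ X ω = 1 := by
  have hs : MeasurableSet {x : ℝ | x = 0 ∨ x = 1} :=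
    (measurableSet_singleton 0).union (measurableSet_singleton 1)
  refine (hX.ae_iff (measurableSet_setOfPred.1 hs)).2 ?_
  rw [ae_iff]
  exact bernoulliMeasure_apply_of_notMem_of_notMem p hs.compl (by simp) (by simp)

lemma charFun_affine_bernoulli {X : Ω → ℝ} (hX : HasLaw X (bernoulliMeasure (1 : ℝ) 0 p) P)
    (b t : ℝ) :
    charFun (P.map fun ω => (X ω - p) * b) t = centredCharFun p (b * t) := by
  have hl : P.map (fun ω => (X ω - p) * b)
      = bernoulliMeasure (((1 : ℝ) - p) * b) ((0 - p) * b) p := by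
    rw [← map_bernoulliMeasure (1 : ℝ) 0 (fun x => (x - p) * b), ← hX.map_eq,
      AEMeasurable.map_map_of_aemeasurable (by fun_prop) hX.aemeasurable]
    rfl
  rw [hl, charFun_apply_real, integral_bernoulliMeasure, centredCharFun]
  simp only [Complex.real_smul]
  push_cast
  congr 3 <;> ring

lemma aemeasurable_weightedSum {X : ℕ → Ω → ℝ}
    (hX : ∀ i, HasLaw (X i) (bernoulliMeasure (1 : ℝ) 0 p) P) (s : Finset ℕ) (w : ℕ → ℝ) :
    AEMeasurable (fun ω => ∑ j ∈ s, X j ω * w j) P :=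
  Finset.aemeasurable_fun_sum _ fun j _ => (hX j).aemeasurable.mul_const _

lemma memLp_of_bernoulli [IsProbabilityMeasure P] {X : Ω → ℝ}
    (hX : HasLaw X (bernoulliMeasure (1 : ℝ) 0 p) P) (q : ENNReal) :
    MemLp X q P := by
  refine MemLp.of_bound hX.aemeasurable.aestronglyMeasurable 1 ?_
  filter_upwards [ae_eq_zero_or_one hX] with ω hω
  rcases hω with h | h <;> simp [h]

lemma integral_bernoulli {X : Ω → ℝ} (hX : HasLaw X (bernoulliMeasure (1 : ℝ) 0 p) P) :
    P[X] = (p : ℝ) := by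
  rw [hX.integral_eq, integral_bernoulliMeasure]
  simp

lemma variance_bernoulli [IsProbabilityMeasure P] {X : Ω → ℝ}
    (hX : HasLaw X (bernoulliMeasure (1 : ℝ) 0 p) P) :
    Var[X; P] = (p : ℝ) * (1 - p) := by
  have h2 : P[X ^ 2] = (p : ℝ) := by
    refine (integral_congr_ae ?_).trans (integral_bernoulli hX)
    filter_upwards [ae_eq_zero_or_one hX] with ω hω
    rcases hω with h | h <;> simp [h]
  rw [variance_eq_sub (memLp_of_bernoulli hX 2), h2, integral_bernoulli hX]
  ring

lemma integral_weightedSum [IsProbabilityMeasure P] {X : ℕ → Ω → ℝ}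
    (hX : ∀ i, HasLaw (X i) (bernoulliMeasure (1 : ℝ) 0 p) P) (s : Finset ℕ) (w : ℕ → ℝ) :
    P[fun ω => ∑ j ∈ s, X j ω * w j] = p * ∑ j ∈ s, w j := by
  rw [integral_finsetSum, Finset.mul_sum]
  · exact Finset.sum_congr rfl fun j _ => by rw [integral_mul_const, integral_bernoulli (hX j)]
  · exact fun j _ => ((memLp_of_bernoulli (hX j) 1).integrable le_rfl).mul_const _

lemma variance_mul_bernoulli [IsProbabilityMeasure P] {X : Ω → ℝ}
    (hX : HasLaw X (bernoulliMeasure (1 : ℝ) 0 p) P) (w : ℝ) :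
    Var[fun ω => X ω * w; P] = (p : ℝ) * (1 - p) * w ^ 2 := by
  simp_rw [mul_comm _ w]
  rw [variance_const_mul, variance_bernoulli hX]
  ring

lemma variance_weightedSum [IsProbabilityMeasure P] {X : ℕ → Ω → ℝ}
    (hX : ∀ i, HasLaw (X i) (bernoulliMeasure (1 : ℝ) 0 p) P) (hind : iIndepFun X P)
    (s : Finset ℕ) (w : ℕ → ℝ) :
    Var[fun ω => ∑ j ∈ s, X j ω * w j; P] = (p : ℝ) * (1 - p) * ∑ j ∈ s, w j ^ 2 := by
  have e : (fun ω => ∑ j ∈ s, X j ω * w j) = ∑ j ∈ s, fun ω => X j ω * w j := by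
    ext ω; simp
  rw [e, IndepFun.variance_sum, Finset.mul_sum]
  · exact Finset.sum_congr rfl fun j _ => variance_mul_bernoulli (hX j) _
  · exact fun j _ => (memLp_of_bernoulli (hX j) 2).mul_const _
  · exact fun i _ j _ hij =>
      (hind.indepFun hij).comp (measurable_id.mul_const (w i)) (measurable_id.mul_const (w j))

lemma charFun_weightedSum {X : ℕ → Ω → ℝ}
    (hX : ∀ i, HasLaw (X i) (bernoulliMeasure (1 : ℝ) 0 p) P) (hind : iIndepFun X P)
    (s : Finset ℕ) (w : ℕ → ℝ) (σ t : ℝ) :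
    charFun (P.map fun ω => (∑ j ∈ s, X j ω * w j - p * ∑ j ∈ s, w j) / σ) t
      = ∏ j ∈ s, centredCharFun p (w j / σ * t) := by
  have e : (fun ω => (∑ j ∈ s, X j ω * w j - p * ∑ j ∈ s, w j) / σ)
      = fun ω => ∑ j ∈ s, (X j ω - p) * (w j / σ) := by
    ext ω
    rw [Finset.mul_sum, ← Finset.sum_sub_distrib, Finset.sum_div]
    exact Finset.sum_congr rfl fun j _ => by ring
  have hind' : iIndepFun (fun j ω => (X j ω - p) * (w j / σ)) P :=
    hind.comp (fun j x => (x - p) * (w j / σ)) fun j => by fun_prop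
  rw [e, (hind'.restrict s).charFun_map_fun_finsetSum_eq_prod
    fun j _ => ((hX j).aemeasurable.sub_const _).mul_const _, Finset.prod_apply]
  exact Finset.prod_congr rfl fun j _ => charFun_affine_bernoulli (hX j) _ _

/-- An atom of a weighted sum is attained at a point where all variables are `0` or `1`. -/
lemma exists_subset_sum_of_atom {X : ℕ → Ω → ℝ}
    (hX : ∀ i, HasLaw (X i) (bernoulliMeasure (1 : ℝ) 0 p) P) (s : Finset ℕ) (y : ℕ → ℕ) (v : ℝ)
    (hv : 0 < P {ω | ∑ j ∈ s, X j ω * (y j : ℝ) = v}) :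
    ∃ F ⊆ s, v = ((∑ j ∈ F, y j : ℕ) : ℝ) := by
  have hfreq : ∃ᵐ ω ∂P, ∑ j ∈ s, X j ω * (y j : ℝ) = v :=
    frequently_ae_iff.2 hv.ne'
  obtain ⟨ω, hω, h01⟩ :=
    (hfreq.and_eventually (ae_all_iff.2 fun i => ae_eq_zero_or_one (hX i))).exists
  classical
  refine ⟨s.filter fun j => X j ω = 1, Finset.filter_subset _ _, ?_⟩
  rw [← hω, Finset.sum_filter]
  push_cast
  refine Finset.sum_congr rfl fun j _ => ?_
  rcases h01 j with h | h <;> simp [h]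

/-- Lindeberg's condition, when the largest weight is negligible against the norming: since
`|ε - p| ≤ 1`, the truncation event is eventually null for every summand at once. -/
lemma lindebergCondition_of_negligible {X : ℕ → Ω → ℝ}
    (hX : ∀ i, HasLaw (X i) (bernoulliMeasure (1 : ℝ) 0 p) P) (J : ℕ → Finset ℕ) (w σ : ℕ → ℝ)
    (h : ∀ δ : ℝ, 0 < δ → ∀ᶠ k in atTop, ∀ i ∈ J k, |w i| ≤ δ * σ k) :
    LindebergCondition P J (fun _ i ω => X i ω * w i - p * w i) σ := by
  intro δ hδ
  refine tendsto_const_nhds.congr' ?_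
  filter_upwards [h δ hδ] with k hk
  rw [Finset.sum_eq_zero, zero_div]
  intro i hi
  refine setIntegral_measure_zero _ (measure_mono_null ?_ (ae_iff.1 (ae_eq_zero_or_one (hX i))))
  intro ω hω h01
  refine absurd ((?_ : |X i ω * w i - p * w i| ≤ |w i|).trans (hk i hi)) (not_le.2 hω)
  rw [← sub_mul, abs_mul]
  refine mul_le_of_le_one_left (abs_nonneg _) (abs_le.2 ?_)
  have h0 := p.2.1
  have h1 := p.2.2
  rcases h01 with h | h <;> rw [h] <;> constructor <;> linarith

end Bernoulli

/-! ### Convergence in distribution -/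

lemma tendstoInDistribution_iff_charFun {Ω Ω' : Type*} [MeasurableSpace Ω] [MeasurableSpace Ω']
    {P : Measure Ω} [IsProbabilityMeasure P] {μ : Measure Ω'} [IsProbabilityMeasure μ]
    {X : ℕ → Ω → ℝ} {Z : Ω' → ℝ} (hX : ∀ k, AEMeasurable (X k) P) (hZ : AEMeasurable Z μ) :
    TendstoInDistribution X atTop Z (fun _ => P) μ ↔
      ∀ t, Tendsto (fun k => charFun (P.map (X k)) t) atTop (𝓝 (charFun (μ.map Z) t)) :=
  ⟨fun h => ProbabilityMeasure.tendsto_iff_tendsto_charFun.1 h.tendsto,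
    fun h => ⟨hX, hZ, ProbabilityMeasure.tendsto_iff_tendsto_charFun.2 h⟩⟩

lemma charFun_map_id_gaussianReal (m : ℝ) (v : NNReal) (t : ℝ) :
    charFun ((gaussianReal m v).map id) t
      = Complex.exp (t * m * Complex.I - v * t ^ 2 / 2) := by
  rw [Measure.map_id, charFun_gaussianReal]

lemma bernoulliMeasure_ne_gaussianReal (a b : ℝ) {p : unitInterval} (hp : 0 < p) (m : ℝ)
    {v : NNReal} (hv : v ≠ 0) : bernoulliMeasure a b p ≠ gaussianReal m v := by
  intro h
  have := nullSingletonClass_gaussianReal (μ := m) hv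
  have h0 : (bernoulliMeasure a b p).real {a} = 0 := by
    rw [h, measureReal_def, measure_singleton, ENNReal.toReal_zero]
  rcases eq_or_ne b a with rfl | hb
  · rw [bernoulliMeasure_real_apply_of_mem_of_mem p (measurableSet_singleton b) rfl rfl] at h0
    exact one_ne_zero h0
  · rw [bernoulliMeasure_real_apply_of_mem_of_notMem p (measurableSet_singleton a) rfl
      (by simpa)] at h0
    exact hp.ne' (Subtype.ext h0)

/-! ### The limits of normed full and trimmed sums -/

/-- If a product `ψ(a_k t) T_k(t)` of characteristic functions converges to that of a Gaussian,
with `T_k` converging to that of a standard Gaussian, then the Bernoulli factor disappears: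
`a_k → 0`. -/
lemma tendsto_zero_of_mul_tendsto_gaussian {p : ℝ} (hp0 : 0 < p) (hp1 : p < 1) {a : ℕ → ℝ}
    {T : ℕ → ℝ → ℂ}
    (hT : ∀ t, Tendsto (fun k => T k t) atTop (𝓝 ((Real.exp (-(t ^ 2 / 2)) : ℝ) : ℂ)))
    (m : ℝ) (v : NNReal)
    (h : ∀ t : ℝ, Tendsto (fun k => centredCharFun p (a k * t) * T k t) atTop
      (𝓝 (Complex.exp (t * m * Complex.I - v * t ^ 2 / 2)))) :
    Tendsto a atTop (𝓝 0) := by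
  refine tendsto_zero_of_tendsto_norm_sq_centredCharFun hp0 hp1 (c := 1 - v) fun t => ?_
  have hne : ‖((Real.exp (-(t ^ 2 / 2)) : ℝ) : ℂ)‖ ≠ 0 := by
    simp [Complex.exp_ne_zero]
  have hlim := ((h t).norm.div (hT t).norm hne).pow 2
  have e : (‖Complex.exp (t * m * Complex.I - v * t ^ 2 / 2)‖
      / ‖((Real.exp (-(t ^ 2 / 2)) : ℝ) : ℂ)‖) ^ 2 = Real.exp ((1 - v) * t ^ 2) := by
    have hre : ((t : ℂ) * m * Complex.I - v * t ^ 2 / 2).re = -(v * t ^ 2 / 2) := by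
      have : ((t : ℂ) * m * Complex.I - v * t ^ 2 / 2)
          = ((t * m : ℝ) : ℂ) * Complex.I - ((v * t ^ 2 / 2 : ℝ) : ℂ) := by push_cast; ring
      rw [this, Complex.sub_re, Complex.re_ofReal_mul, Complex.I_re, Complex.ofReal_re]
      ring
    rw [Complex.norm_exp, hre, Complex.norm_real, Real.norm_of_nonneg (Real.exp_pos _).le,
      ← Real.exp_sub, ← Real.exp_nat_mul]
    congr 1
    push_cast
    ring
  rw [e] at hlim
  refine hlim.congr' ?_
  filter_upwards [(hT t).norm.eventually_ne hne] with k hk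
  rw [Pi.div_apply, norm_mul, mul_div_cancel_right₀ _ hk]

section Weighted

variable {Ω : Type*} [MeasurableSpace Ω] {P : Measure Ω} {p : unitInterval}
  {X : ℕ → Ω → ℝ}

/-- When a single weight carries asymptotically all of the variance, the normed sum has the
limit law of the corresponding normed single variable. -/
lemma tendsto_charFun_of_dominated
    (hX : ∀ i, HasLaw (X i) (bernoulliMeasure (1 : ℝ) 0 p) P) (hind : iIndepFun X P)
    (hp0 : 0 < (p : ℝ)) (hp1 : (p : ℝ) < 1) (w : ℕ → ℝ) (hw : ∀ i, 0 ≤ w i) (j : ℕ → ℕ)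
    (hj : ∀ k, 1 ≤ k → j k < k)
    (hpos : ∀ᶠ k in atTop, 0 < ∑ i ∈ Finset.range k, w i ^ 2)
    (hdom : Tendsto (fun k => w (j k) ^ 2 / ∑ i ∈ Finset.range k, w i ^ 2) atTop (𝓝 1)) (t : ℝ) :
    Tendsto (fun k => charFun (P.map fun ω => (∑ i ∈ Finset.range k, X i ω * w i
        - p * ∑ i ∈ Finset.range k, w i) / √(p * (1 - p) * ∑ i ∈ Finset.range k, w i ^ 2)) t) atTop
      (𝓝 (centredCharFun p (1 / √((p : ℝ) * (1 - p)) * t))) := by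
  have hq : 0 < (p : ℝ) * (1 - p) := mul_pos hp0 (by linarith)
  simp_rw [charFun_weightedSum hX hind]
  set σ : ℕ → ℝ := fun k => √(p * (1 - p) * ∑ i ∈ Finset.range k, w i ^ 2)
  have hσsq (k : ℕ) : σ k ^ 2 = p * (1 - p) * ∑ i ∈ Finset.range k, w i ^ 2 :=
    Real.sq_sqrt (mul_nonneg hq.le (Finset.sum_nonneg fun i _ => sq_nonneg _))
  have hlead : Tendsto (fun k => w (j k) / σ k) atTop (𝓝 (1 / √((p : ℝ) * (1 - p)))) := by
    have h1 := (hdom.div_const ((p : ℝ) * (1 - p))).sqrt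
    rw [Real.sqrt_div zero_le_one, Real.sqrt_one] at h1
    refine h1.congr fun k => ?_
    rw [div_div, mul_comm _ ((p : ℝ) * (1 - p)), ← hσsq, ← div_pow,
      Real.sqrt_sq (div_nonneg (hw _) (Real.sqrt_nonneg _))]
  have hrest : Tendsto (fun k => ∑ i ∈ (Finset.range k).erase (j k), (w i / σ k) ^ 2) atTop
      (𝓝 0) := by
    have h1 := (hdom.const_sub 1).div_const ((p : ℝ) * (1 - p))
    rw [sub_self, zero_div] at h1
    refine h1.congr' ?_
    filter_upwards [hpos, eventually_ge_atTop 1] with k hk hk1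
    simp_rw [div_pow]
    rw [← Finset.sum_div, hσsq, Finset.sum_erase_eq_sub (Finset.mem_range.2 (hj k hk1))]
    field_simp
  have hprod := tendsto_prod_centredCharFun_one hp0.le hp1.le
    (fun k => (Finset.range k).erase (j k)) (fun k i => w i / σ k) hrest t
  have hfac := ((continuous_centredCharFun p).tendsto _).comp (hlead.mul_const t)
  have := hfac.mul hprod
  rw [mul_one] at this
  refine this.congr' ?_
  filter_upwards [eventually_ge_atTop 1] with k hk
  exact Finset.mul_prod_erase _ (fun i => centredCharFun p (w i / σ k * t))
    (Finset.mem_range.2 (hj k hk))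

/-- The Lindeberg central limit theorem for weighted Bernoulli sums over a triangular array of
index sets, under uniform negligibility of the weights. -/
lemma tendsto_charFun_of_negligible
    (hX : ∀ i, HasLaw (X i) (bernoulliMeasure (1 : ℝ) 0 p) P) (hind : iIndepFun X P)
    (hp0 : 0 < (p : ℝ)) (hp1 : (p : ℝ) < 1) (w : ℕ → ℝ) (J : ℕ → Finset ℕ) (M : ℕ → ℝ)
    (hM : ∀ k, ∀ i ∈ J k, w i ^ 2 ≤ M k)
    (hpos : ∀ᶠ k in atTop, 0 < ∑ i ∈ J k, w i ^ 2)
    (hneg : Tendsto (fun k => M k / ∑ i ∈ J k, w i ^ 2) atTop (𝓝 0)) (t : ℝ) :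
    Tendsto (fun k => charFun (P.map fun ω => (∑ i ∈ J k, X i ω * w i
        - p * ∑ i ∈ J k, w i) / √(p * (1 - p) * ∑ i ∈ J k, w i ^ 2)) t) atTop
      (𝓝 ((Real.exp (-(t ^ 2 / 2)) : ℝ) : ℂ)) := by
  have hq : 0 < (p : ℝ) * (1 - p) := mul_pos hp0 (by linarith)
  simp_rw [charFun_weightedSum hX hind]
  have hm : Tendsto (fun k => √(M k / (p * (1 - p) * ∑ i ∈ J k, w i ^ 2))) atTop (𝓝 0) := by
    have h1 := (hneg.div_const ((p : ℝ) * (1 - p))).sqrt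
    rw [zero_div, Real.sqrt_zero] at h1
    refine h1.congr fun k => ?_
    rw [div_div, mul_comm (∑ i ∈ J k, w i ^ 2)]
  refine tendsto_prod_centredCharFun hp0.le hp1.le J
    (fun k i => w i / √(p * (1 - p) * ∑ i ∈ J k, w i ^ 2)) _ ?_ ?_ hm t
  · filter_upwards [hpos] with k hk
    simp_rw [div_pow, Real.sq_sqrt (mul_pos hq hk).le]
    rw [← Finset.sum_div, ← mul_div_assoc, div_self (mul_pos hq hk).ne']
  · filter_upwards [hpos] with k hk i hi
    refine Real.abs_le_sqrt ?_
    rw [div_pow, Real.sq_sqrt (mul_pos hq hk).le]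
    have := hM k i hi
    have := mul_pos hq hk
    gcongr

/-- The summand left out by trimming contributes one Bernoulli factor to the characteristic
function of the full sum. -/
lemma charFun_weightedSum_eq_mul_erase
    (hX : ∀ i, HasLaw (X i) (bernoulliMeasure (1 : ℝ) 0 p) P) (hind : iIndepFun X P)
    (w : ℕ → ℝ) (s : Finset ℕ) {i : ℕ} (hi : i ∈ s) (σ t : ℝ) :
    charFun (P.map fun ω => (∑ j ∈ s, X j ω * w j - p * ∑ j ∈ s, w j) / σ) t
      = centredCharFun p (w i / σ * t) *
        charFun (P.map fun ω => (∑ j ∈ s.erase i, X j ω * w j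
          - p * ∑ j ∈ s.erase i, w j) / σ) t := by
  rw [charFun_weightedSum hX hind, charFun_weightedSum hX hind]
  exact (Finset.mul_prod_erase _ (fun j => centredCharFun p (w j / σ * t)) hi).symm

end Weighted

/-! ### Atoms and finite sums -/

lemma sum_subsequence_mem_FS {x n y : ℕ → ℕ} (hn : Function.Injective n)
    (hy : ∀ j, y j = x (n j)) {F : Finset ℕ} (hF : F.Nonempty) :
    ∑ j ∈ F, y j ∈ Hindman.FS (M := ℕ) x := by
  have h := Hindman.FS.finsetSum (M := ℕ) x (F.map ⟨n, hn⟩) (hF.map)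
  rw [Finset.sum_map] at h
  simp_rw [hy]
  exact h

/-! ### Full and trimmed sums along a subsequence -/

section Sums

variable {Ω : Type*} [MeasurableSpace Ω] {P : Measure Ω}
  {p : unitInterval} {ε : ℕ → Ω → ℝ} {n y j : ℕ → ℕ}

lemma aemeasurable_normed_fullSum
    (hX : ∀ i, HasLaw (ε (n i)) (bernoulliMeasure (1 : ℝ) 0 p) P) (k : ℕ) (b σ : ℝ) :
    AEMeasurable (fun ω => (fullSum ε n y k ω - b) / σ) P :=
  ((aemeasurable_weightedSum hX _ _).sub_const _).div_const _

lemma aemeasurable_normed_trimmedSum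
    (hX : ∀ i, HasLaw (ε (n i)) (bernoulliMeasure (1 : ℝ) 0 p) P) (i k : ℕ) (b σ : ℝ) :
    AEMeasurable (fun ω => (trimmedSum ε n y i k ω - b) / σ) P :=
  ((aemeasurable_weightedSum hX _ _).sub_const _).div_const _

lemma residual_nonneg (y : ℕ → ℕ) (i k : ℕ) : 0 ≤ residual y i k :=
  Finset.sum_nonneg fun _ _ => sq_nonneg _

lemma sq_le_maxRemaining {y : ℕ → ℕ} {i k l : ℕ} (hl : l ∈ (Finset.range k).erase i) :
    (y l : ℝ) ^ 2 ≤ (maxRemaining y i k : ℝ) :=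
  mod_cast Finset.le_sup (f := fun l => y l ^ 2) hl

lemma sq_div_residual {q : ℝ} (hq : 0 < q * (1 - q)) (y : ℕ → ℕ) (i k : ℕ) :
    (y i : ℝ) ^ 2 / residual y i k = q * (1 - q) * ((y i : ℝ) / trimmedSd q y i k) ^ 2 := by
  rw [trimmedSd, div_pow, Real.sq_sqrt (mul_nonneg hq.le (residual_nonneg y i k)),
    ← mul_div_assoc, mul_div_mul_left _ _ hq.ne']

lemma lindebergCondition_trimmedSum
    (hX : ∀ i, HasLaw (ε (n i)) (bernoulliMeasure (1 : ℝ) 0 p) P)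
    (hq : 0 < (p : ℝ) * (1 - p)) (hR : ∀ᶠ k in atTop, 0 < residual y (j k) k)
    (hneg : Tendsto (fun k => (maxRemaining y (j k) k : ℝ) / residual y (j k) k) atTop (𝓝 0)) :
    LindebergCondition P (fun k => (Finset.range k).erase (j k))
      (fun _ i ω => ε (n i) ω * (y i : ℝ) - p * (y i : ℝ)) (fun k => trimmedSd p y (j k) k) := by
  refine lindebergCondition_of_negligible hX _ (fun i => (y i : ℝ)) _ fun δ hδ => ?_
  have hδq : 0 < δ ^ 2 * (p * (1 - p)) := by positivity
  filter_upwards [hR, hneg.eventually (gt_mem_nhds hδq)] with k hk1 hk2 i hi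
  rw [div_lt_iff₀ hk1] at hk2
  refine abs_le_of_sq_le_sq ?_ (mul_nonneg hδ.le (Real.sqrt_nonneg _))
  rw [mul_pow, trimmedSd, Real.sq_sqrt (mul_nonneg hq.le hk1.le), ← mul_assoc]
  exact (sq_le_maxRemaining hi).trans hk2.le

variable [IsProbabilityMeasure P]

lemma integral_fullSum (hX : ∀ i, HasLaw (ε (n i)) (bernoulliMeasure (1 : ℝ) 0 p) P) (k : ℕ) :
    P[fullSum ε n y k] = (p : ℝ) * ∑ i ∈ Finset.range k, (y i : ℝ) :=
  integral_weightedSum hX _ _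

lemma variance_fullSum (hX : ∀ i, HasLaw (ε (n i)) (bernoulliMeasure (1 : ℝ) 0 p) P)
    (hind : iIndepFun (fun i => ε (n i)) P) (k : ℕ) :
    Var[fullSum ε n y k; P] = (p : ℝ) * (1 - p) * ∑ i ∈ Finset.range k, (y i : ℝ) ^ 2 :=
  variance_weightedSum hX hind _ _

lemma integral_trimmedSum (hX : ∀ i, HasLaw (ε (n i)) (bernoulliMeasure (1 : ℝ) 0 p) P)
    (i k : ℕ) :
    P[trimmedSum ε n y i k] = (p : ℝ) * ∑ l ∈ (Finset.range k).erase i, (y l : ℝ) :=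
  integral_weightedSum hX _ _

lemma variance_trimmedSum (hX : ∀ i, HasLaw (ε (n i)) (bernoulliMeasure (1 : ℝ) 0 p) P)
    (hind : iIndepFun (fun i => ε (n i)) P) (i k : ℕ) :
    Var[trimmedSum ε n y i k; P] = (p : ℝ) * (1 - p) * residual y i k :=
  variance_weightedSum hX hind _ _

/-- In the dominated regime the normed full sum behaves like its single dominant summand. -/
lemma tendstoInDistribution_fullSum_of_dominated
    (hX : ∀ i, HasLaw (ε (n i)) (bernoulliMeasure (1 : ℝ) 0 p) P)
    (hind : iIndepFun (fun i => ε (n i)) P) (hp0 : 0 < (p : ℝ)) (hp1 : (p : ℝ) < 1)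
    (hj : IsIndexChoice j)
    (hdiv : Tendsto (fun k => ∑ i ∈ Finset.range k, (y i : ℝ) ^ 2) atTop atTop)
    (hdom : Tendsto (fun k => (y (j k) : ℝ) ^ 2 / ∑ i ∈ Finset.range k, (y i : ℝ) ^ 2)
      atTop (𝓝 1)) :
    TendstoInDistribution
      (fun k ω => (fullSum ε n y k ω - P[fullSum ε n y k]) / √(Var[fullSum ε n y k; P])) atTop
      (fun b : ℝ => (b - p) / √((p : ℝ) * (1 - p)))
      (fun _ => P) (bernoulliMeasure (1 : ℝ) 0 p) := by
  refine (tendstoInDistribution_iff_charFun (fun k => aemeasurable_normed_fullSum hX k _ _)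
    (by fun_prop)).2 fun t => ?_
  simp_rw [integral_fullSum hX, variance_fullSum hX hind]
  have e := charFun_affine_bernoulli
    (HasLaw.id (μ := bernoulliMeasure (1 : ℝ) 0 p)) (1 / √((p : ℝ) * (1 - p))) t
  simp_rw [id, mul_one_div] at e
  rw [e]
  exact tendsto_charFun_of_dominated hX hind hp0 hp1 (fun i => (y i : ℝ))
    (fun i => Nat.cast_nonneg _) j hj (hdiv.eventually_gt_atTop 0) hdom t

lemma tendstoInDistribution_bernoulliMeasure_iff {S : ℕ → Ω → ℝ} {p : unitInterval} (b c : ℝ) :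
    TendstoInDistribution S atTop (fun x : ℝ => (x - b) / c) (fun _ => P)
        (bernoulliMeasure (1 : ℝ) 0 p) ↔
      TendstoInDistribution S atTop (id : ℝ → ℝ) (fun _ => P)
        (bernoulliMeasure ((1 - b) / c) (-b / c) p) := by
  have e := map_bernoulliMeasure (1 : ℝ) 0 (fun x : ℝ => (x - b) / c) p
  rw [zero_sub] at e
  constructor <;> intro h <;> have hm := h.forall_aemeasurable <;>
    rw [tendstoInDistribution_iff_charFun hm (by fun_prop)] at h ⊢ <;>
    simpa only [e, Measure.map_id] using h

lemma tendsto_charFun_trimmedSum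
    (hX : ∀ i, HasLaw (ε (n i)) (bernoulliMeasure (1 : ℝ) 0 p) P)
    (hind : iIndepFun (fun i => ε (n i)) P) (hp0 : 0 < (p : ℝ)) (hp1 : (p : ℝ) < 1)
    (hR : ∀ᶠ k in atTop, 0 < residual y (j k) k)
    (hneg : Tendsto (fun k => (maxRemaining y (j k) k : ℝ) / residual y (j k) k) atTop (𝓝 0))
    (t : ℝ) :
    Tendsto (fun k => charFun (P.map fun ω =>
        (trimmedSum ε n y (j k) k ω - P[trimmedSum ε n y (j k) k]) / trimmedSd p y (j k) k) t) atTop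
      (𝓝 ((Real.exp (-(t ^ 2 / 2)) : ℝ) : ℂ)) := by
  simp_rw [integral_trimmedSum hX]
  exact tendsto_charFun_of_negligible hX hind hp0 hp1 (fun i => (y i : ℝ))
    (fun k => (Finset.range k).erase (j k)) _ (fun k i hi => sq_le_maxRemaining hi) hR hneg t

lemma charFun_fullSum_eq_mul_trimmedSum
    (hX : ∀ i, HasLaw (ε (n i)) (bernoulliMeasure (1 : ℝ) 0 p) P)
    (hind : iIndepFun (fun i => ε (n i)) P) {i k : ℕ} (hi : i < k) (σ t : ℝ) :
    charFun (P.map fun ω => (fullSum ε n y k ω - P[fullSum ε n y k]) / σ) t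
      = centredCharFun p ((y i : ℝ) / σ * t) * charFun (P.map fun ω =>
          (trimmedSum ε n y i k ω - P[trimmedSum ε n y i k]) / σ) t := by
  simp_rw [integral_fullSum hX, integral_trimmedSum hX]
  exact charFun_weightedSum_eq_mul_erase hX hind (fun i => (y i : ℝ)) _ (Finset.mem_range.2 hi) σ t

lemma charFun_map_id_gaussianReal_std (t : ℝ) :
    charFun ((gaussianReal 0 1).map id) t = ((Real.exp (-(t ^ 2 / 2)) : ℝ) : ℂ) := by
  rw [charFun_map_id_gaussianReal]
  push_cast
  congr 1
  ring

lemma tendstoInDistribution_trimmedSum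
    (hX : ∀ i, HasLaw (ε (n i)) (bernoulliMeasure (1 : ℝ) 0 p) P)
    (hind : iIndepFun (fun i => ε (n i)) P) (hp0 : 0 < (p : ℝ)) (hp1 : (p : ℝ) < 1)
    (hR : ∀ᶠ k in atTop, 0 < residual y (j k) k)
    (hneg : Tendsto (fun k => (maxRemaining y (j k) k : ℝ) / residual y (j k) k) atTop (𝓝 0)) :
    TendstoInDistribution (fun k ω =>
        (trimmedSum ε n y (j k) k ω - P[trimmedSum ε n y (j k) k]) / trimmedSd p y (j k) k) atTop
      (id : ℝ → ℝ) (fun _ => P) (gaussianReal 0 1) := by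
  refine (tendstoInDistribution_iff_charFun
    (fun k => aemeasurable_normed_trimmedSum hX _ k _ _) (by fun_prop)).2 fun t => ?_
  rw [charFun_map_id_gaussianReal_std]
  exact tendsto_charFun_trimmedSum hX hind hp0 hp1 hR hneg t

/-- If the omitted summand is negligible as well, its Bernoulli factor tends to `1` and the full
sum inherits the limit of the trimmed sum. -/
lemma tendstoInDistribution_fullSum_of_negligible
    (hX : ∀ i, HasLaw (ε (n i)) (bernoulliMeasure (1 : ℝ) 0 p) P)
    (hind : iIndepFun (fun i => ε (n i)) P) (hp0 : 0 < (p : ℝ)) (hp1 : (p : ℝ) < 1)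
    (hj : IsIndexChoice j) (hR : ∀ᶠ k in atTop, 0 < residual y (j k) k)
    (hneg : Tendsto (fun k => (maxRemaining y (j k) k : ℝ) / residual y (j k) k) atTop (𝓝 0))
    (hsmall : Tendsto (fun k => (y (j k) : ℝ) ^ 2 / residual y (j k) k) atTop (𝓝 0)) :
    TendstoInDistribution (fun k ω =>
        (fullSum ε n y k ω - P[fullSum ε n y k]) / trimmedSd p y (j k) k) atTop
      (id : ℝ → ℝ) (fun _ => P) (gaussianReal 0 1) := by
  have hq : 0 < (p : ℝ) * (1 - p) := mul_pos hp0 (by linarith)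
  refine (tendstoInDistribution_iff_charFun
    (fun k => aemeasurable_normed_fullSum hX k _ _) (by fun_prop)).2 fun t => ?_
  rw [charFun_map_id_gaussianReal_std]
  have ha : Tendsto (fun k => (y (j k) : ℝ) / trimmedSd p y (j k) k) atTop (𝓝 0) := by
    have h1 := (hsmall.div_const ((p : ℝ) * (1 - p))).sqrt
    rw [zero_div, Real.sqrt_zero] at h1
    refine h1.congr fun k => ?_
    rw [sq_div_residual hq, mul_div_cancel_left₀ _ hq.ne']
    exact Real.sqrt_sq (div_nonneg (Nat.cast_nonneg _) (Real.sqrt_nonneg _))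
  have h0 : Tendsto (fun k => centredCharFun p ((y (j k) : ℝ) / trimmedSd p y (j k) k * t))
      atTop (𝓝 1) := by
    have := ((continuous_centredCharFun p).tendsto _).comp (ha.mul_const t)
    rwa [zero_mul, centredCharFun_zero] at this
  have := h0.mul (tendsto_charFun_trimmedSum hX hind hp0 hp1 hR hneg t)
  rw [one_mul] at this
  refine this.congr' ?_
  filter_upwards [eventually_ge_atTop 1] with k hk
  exact (charFun_fullSum_eq_mul_trimmedSum hX hind (hj k hk) _ t).symm

/-- Conversely, a Gaussian limit (degenerate or not) of the full sum makes the omitted summand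
negligible. -/
lemma tendsto_zero_of_tendstoInDistribution_fullSum
    (hX : ∀ i, HasLaw (ε (n i)) (bernoulliMeasure (1 : ℝ) 0 p) P)
    (hind : iIndepFun (fun i => ε (n i)) P) (hp0 : 0 < (p : ℝ)) (hp1 : (p : ℝ) < 1)
    (hj : IsIndexChoice j) (hR : ∀ᶠ k in atTop, 0 < residual y (j k) k)
    (hneg : Tendsto (fun k => (maxRemaining y (j k) k : ℝ) / residual y (j k) k) atTop (𝓝 0))
    {m : ℝ} {v : NNReal}
    (h : TendstoInDistribution (fun k ω =>
        (fullSum ε n y k ω - P[fullSum ε n y k]) / trimmedSd p y (j k) k) atTop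
      (id : ℝ → ℝ) (fun _ => P) (gaussianReal m v)) :
    Tendsto (fun k => (y (j k) : ℝ) ^ 2 / residual y (j k) k) atTop (𝓝 0) := by
  have hq : 0 < (p : ℝ) * (1 - p) := mul_pos hp0 (by linarith)
  rw [tendstoInDistribution_iff_charFun
    (fun k => aemeasurable_normed_fullSum hX k _ _) (by fun_prop)] at h
  have ha := tendsto_zero_of_mul_tendsto_gaussian hp0 hp1
    (a := fun k => (y (j k) : ℝ) / trimmedSd p y (j k) k)
    (tendsto_charFun_trimmedSum hX hind hp0 hp1 hR hneg) m v fun t => by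
      rw [← charFun_map_id_gaussianReal]
      refine (h t).congr' ?_
      filter_upwards [eventually_ge_atTop 1] with k hk
      exact charFun_fullSum_eq_mul_trimmedSum hX hind (hj k hk) _ t
  simp_rw [sq_div_residual hq]
  simpa using (ha.pow 2).const_mul ((p : ℝ) * (1 - p))

end Sums

end HindmanCLT

theorem theorem4p1
    -- a finite colouring and a sequence with monochromatic finite sums
    {κ : Type*} [Finite κ] (c : ℕ → κ) (x : ℕ → ℕ)
    (hmono : ∃ a : κ, ∀ m ∈ Hindman.FS (M := ℕ) x, c m = a)
    -- i.i.d. Bernoulli weights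
    {Ω : Type*} [MeasurableSpace Ω] (P : Measure Ω) [IsProbabilityMeasure P]
    (p : unitInterval) (hp0 : 0 < p) (hp1 : p < 1)
    (ε : ℕ → Ω → ℝ) (hlaw : ∀ i, HasLaw (ε i) (bernoulliMeasure (1 : ℝ) 0 p) P)
    (hindep : iIndepFun ε P)
    -- a subsequence of distinct elements, with divergent sum of squares
    (n : ℕ → ℕ) (hn : StrictMono n) (y : ℕ → ℕ) (hy : ∀ j, y j = x (n j))
    (hinj : Function.Injective y)
    (hdiv : Tendsto (fun k => ∑ j ∈ Finset.range k, (y j : ℝ) ^ 2) atTop atTop) :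
    -- means and variances of the full sums and of all trimmed sums
    (∀ k, P[HindmanCLT.fullSum ε n y k] = (p : ℝ) * ∑ j ∈ Finset.range k, (y j : ℝ) ∧
      Var[HindmanCLT.fullSum ε n y k; P]
        = (p : ℝ) * (1 - p) * ∑ j ∈ Finset.range k, (y j : ℝ) ^ 2) ∧
    (∀ i k, P[HindmanCLT.trimmedSum ε n y i k]
        = (p : ℝ) * ∑ j ∈ (Finset.range k).erase i, (y j : ℝ) ∧
      Var[HindmanCLT.trimmedSum ε n y i k; P] = (p : ℝ) * (1 - p) * HindmanCLT.residual y i k) ∧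
    -- (A) the dominated regime
    (∀ j : ℕ → ℕ, HindmanCLT.IsArgmaxChoice y j →
      Tendsto (fun k => (y (j k) : ℝ) ^ 2 / ((y (j k) : ℝ) ^ 2 + HindmanCLT.residual y (j k) k))
        atTop (𝓝 1) →
      Tendsto (fun k => Var[fun ω => ε (n (j k)) ω * (y (j k) : ℝ); P] /
        Var[HindmanCLT.fullSum ε n y k; P]) atTop (𝓝 1) ∧
      TendstoInDistribution
        (fun k ω => (HindmanCLT.fullSum ε n y k ω - P[HindmanCLT.fullSum ε n y k]) /
          √(Var[HindmanCLT.fullSum ε n y k; P])) atTop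
        (fun b : ℝ => (b - p) / √((p : ℝ) * (1 - p)))
        (fun _ => P) (bernoulliMeasure (1 : ℝ) 0 p) ∧
      TendstoInDistribution
        (fun k ω => (HindmanCLT.fullSum ε n y k ω - P[HindmanCLT.fullSum ε n y k]) /
          √(Var[HindmanCLT.fullSum ε n y k; P])) atTop
        (id : ℝ → ℝ) (fun _ => P)
        (bernoulliMeasure ((1 - p) / √((p : ℝ) * (1 - p))) (-p / √((p : ℝ) * (1 - p))) p) ∧
      ∀ (m : ℝ) (v : NNReal), v ≠ 0 →
        ¬ TendstoInDistribution
          (fun k ω => (HindmanCLT.fullSum ε n y k ω - P[HindmanCLT.fullSum ε n y k]) /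
            √(Var[HindmanCLT.fullSum ε n y k; P])) atTop
          (id : ℝ → ℝ) (fun _ => P) (gaussianReal m v)) ∧
    -- (B) the trimmed regime
    (∀ j : ℕ → ℕ, HindmanCLT.IsIndexChoice j →
      Tendsto (fun k => (p : ℝ) * (1 - p) * HindmanCLT.residual y (j k) k) atTop atTop →
      Tendsto (fun k => (HindmanCLT.maxRemaining y (j k) k : ℝ) / HindmanCLT.residual y (j k) k)
        atTop (𝓝 0) →
      HindmanCLT.LindebergCondition P (fun k => (Finset.range k).erase (j k))
        (fun _ i ω => ε (n i) ω * (y i : ℝ) - p * (y i : ℝ))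
        (fun k => HindmanCLT.trimmedSd p y (j k) k) ∧
      TendstoInDistribution
        (fun k ω => (HindmanCLT.trimmedSum ε n y (j k) k ω -
          P[HindmanCLT.trimmedSum ε n y (j k) k]) / HindmanCLT.trimmedSd p y (j k) k) atTop
        (id : ℝ → ℝ) (fun _ => P) (gaussianReal 0 1) ∧
      (Tendsto (fun k => (y (j k) : ℝ) ^ 2 / HindmanCLT.residual y (j k) k) atTop (𝓝 0) →
        TendstoInDistribution
          (fun k ω => (HindmanCLT.fullSum ε n y k ω - P[HindmanCLT.fullSum ε n y k]) /
            HindmanCLT.trimmedSd p y (j k) k) atTop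
          (id : ℝ → ℝ) (fun _ => P) (gaussianReal 0 1)) ∧
      (¬ Tendsto (fun k => (y (j k) : ℝ) ^ 2 / HindmanCLT.residual y (j k) k) atTop (𝓝 0) →
        ∀ (m : ℝ) (v : NNReal),
          ¬ TendstoInDistribution
            (fun k ω => (HindmanCLT.fullSum ε n y k ω - P[HindmanCLT.fullSum ε n y k]) /
              HindmanCLT.trimmedSd p y (j k) k) atTop
            (id : ℝ → ℝ) (fun _ => P) (gaussianReal m v))) ∧
    -- atoms of the full sums and of all trimmed sums
    (∀ (k : ℕ) (v : ℝ), 0 < P {ω | HindmanCLT.fullSum ε n y k ω = v} →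
      ∃ F ⊆ Finset.range k, v = ((∑ j ∈ F, y j : ℕ) : ℝ) ∧
        (v ≠ 0 → ∑ j ∈ F, y j ∈ Hindman.FS (M := ℕ) x)) ∧
    (∀ (i k : ℕ) (v : ℝ), 0 < P {ω | HindmanCLT.trimmedSum ε n y i k ω = v} →
      ∃ F ⊆ (Finset.range k).erase i, v = ((∑ j ∈ F, y j : ℕ) : ℝ) ∧
        (v ≠ 0 → ∑ j ∈ F, y j ∈ Hindman.FS (M := ℕ) x)) := by
  have hp0' : 0 < (p : ℝ) := hp0
  have hp1' : (p : ℝ) < 1 := hp1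
  have hq : 0 < (p : ℝ) * (1 - p) := mul_pos hp0' (by linarith)
  have hX : ∀ j, HasLaw (ε (n j)) (bernoulliMeasure (1 : ℝ) 0 p) P := fun j => hlaw _
  have hind : iIndepFun (fun j => ε (n j)) P := hindep.precomp hn.injective
  have hatom (s : Finset ℕ) (v : ℝ) (hv : 0 < P {ω | ∑ j ∈ s, ε (n j) ω * (y j : ℝ) = v}) :
      ∃ F ⊆ s, v = ((∑ j ∈ F, y j : ℕ) : ℝ) ∧
        (v ≠ 0 → ∑ j ∈ F, y j ∈ Hindman.FS (M := ℕ) x) := by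
    obtain ⟨F, hF, rfl⟩ := HindmanCLT.exists_subset_sum_of_atom hX s y v hv
    refine ⟨F, hF, rfl, fun h0 => HindmanCLT.sum_subsequence_mem_FS hn.injective hy ?_⟩
    rw [Finset.nonempty_iff_ne_empty]
    rintro rfl
    simp at h0
  refine ⟨fun k => ⟨HindmanCLT.integral_fullSum hX k, HindmanCLT.variance_fullSum hX hind k⟩,
    fun i k => ⟨HindmanCLT.integral_trimmedSum hX i k, HindmanCLT.variance_trimmedSum hX hind i k⟩,
    ?_, ?_, fun k v hv => hatom _ v hv, fun i k v hv => hatom _ v hv⟩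
  · intro j hj hdom
    have hdom' : Tendsto (fun k => (y (j k) : ℝ) ^ 2 / ∑ i ∈ Finset.range k, (y i : ℝ) ^ 2)
        atTop (𝓝 1) := by
      refine hdom.congr' ?_
      filter_upwards [eventually_ge_atTop 1] with k hk
      rw [HindmanCLT.residual,
        Finset.add_sum_erase _ (fun i => (y i : ℝ) ^ 2) (Finset.mem_range.2 (hj k hk).1)]
    have hdist := HindmanCLT.tendstoInDistribution_fullSum_of_dominated hX hind hp0' hp1'
      (fun k hk => (hj k hk).1) hdiv hdom'
    have hdist' := (HindmanCLT.tendstoInDistribution_bernoulliMeasure_iff _ _).1 hdist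
    refine ⟨?_, hdist, hdist', fun m v hv h => ?_⟩
    · refine hdom'.congr fun k => ?_
      rw [HindmanCLT.variance_mul_bernoulli (hX _), HindmanCLT.variance_fullSum hX hind,
        mul_div_mul_left _ _ hq.ne']
    · have := tendstoInDistribution_unique _ hdist' h
      rw [Measure.map_id, Measure.map_id] at this
      exact HindmanCLT.bernoulliMeasure_ne_gaussianReal _ _ hp0 m hv this
  · intro j hj hR hneg
    have hRpos : ∀ᶠ k in atTop, 0 < HindmanCLT.residual y (j k) k := by
      filter_upwards [hR.eventually_gt_atTop 0] with k hk
      exact pos_of_mul_pos_right hk hq.le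
    exact ⟨HindmanCLT.lindebergCondition_trimmedSum hX hq hRpos hneg,
      HindmanCLT.tendstoInDistribution_trimmedSum hX hind hp0' hp1' hRpos hneg,
      HindmanCLT.tendstoInDistribution_fullSum_of_negligible hX hind hp0' hp1' hj hRpos hneg,
      fun hbig m v h => hbig (HindmanCLT.tendsto_zero_of_tendstoInDistribution_fullSum
        hX hind hp0' hp1' hj hRpos hneg h)⟩
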